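/- Let $X$ be a connected finite CW-complex, let $Y$ be a (topological) manifold without boundary, and let $f_1,\dots,f_k : X \to Y$ be continuous maps. Put $\mathrm{Coin}(f_1,\dots,f_k)=\{x\in X : f_1(x)=\dots=f_k(x)\}$. Two points $x_0,x_1\in \mathrm{Coin}(f_1,\dots,f_k)$ are Nielsen equivalent if there is a path $\gamma:[0,1]\to X$ from $x_0$ to $x_1$ such that $f_1\circ\gamma$ is homotopic to $f_j\circ\gamma$ relative to the endpoints for $j=2,\dots,k$; the equivalence classes are the Nielsen coincidence classes of $(f_1,\dots,f_k)$. A Nielsen coincidence class $\mathcal F$ of $(f_1,\dots,f_k)$ is (geometrically) essential if for all homotopies $\{f_1^t\},\dots,\{f_k^t\}$, $t\in[0,1]$, with $f_i^0=f_i$, there are a Nielsen coincidence class $\mathcal F'$ of $(f_1^1,\dots,f_k^1)$, points $x\in\mathcal F$ and $x'\in\mathcal F'$, and a path $\gamma$ in $X$ from $x$ to $x'$ such that the paths $t\mapsto f_1^t(\gamma(t))$ and $t\mapsto f_i^t(\gamma(t))$ are homotopic relative to the endpoints for $i=2,\dots,k$. The geometric Nielsen coincidence number $N(f_1,\dots,f_k)$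 is the number of essential Nielsen coincidence classes of $(f_1,\dots,f_k)$. Let $F,G:X\to Y^{k-1}$ be $F=(f_1,f_1,\dots,f_1)$ and $G=(f_2,f_3,\dots,f_k)$. Then $$N(f_1,\dots,f_k)=N(F,G),$$ where $N(F,G)$ is the geometric Nielsen coincidence number of the pair of maps $F,G$ (the same definition applied to two maps with target $Y^{k-1}$). -/

import Mathlib

open scoped unitInterval

namespace MultiCoincidence

section

variable {X Y : Type*} [TopologicalSpace X] [TopologicalSpace Y] {m : ℕ}

/-- The coincidence set of the `m + 1` maps `f 0, …, f m`. -/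
def coin (f : Fin (m + 1) → C(X, Y)) : Set X :=
  {x | ∀ i j, f i x = f j x}

/-- Two coincidences are Nielsen equivalent if some path `γ` joins them in `X` whose image under
the first map is homotopic, relative to the endpoints, to its image under every other map. -/
def NielsenEquiv (f : Fin (m + 1) → C(X, Y)) (x₀ x₁ : coin f) : Prop :=
  ∃ γ : Path (x₀ : X) (x₁ : X), ∀ j : Fin m,
    ContinuousMap.HomotopicRel ((f 0).comp γ.toContinuousMap)
      ((f j.succ).comp γ.toContinuousMap) {0, 1}

theorem nielsenEquiv_refl (f : Fin (m + 1) → C(X, Y)) (x : coin f) : NielsenEquiv f x x := by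
  refine ⟨Path.refl _, fun j => ?_⟩
  have h : (f 0).comp (Path.refl (x : X)).toContinuousMap
      = (f j.succ).comp (Path.refl (x : X)).toContinuousMap := by
    ext t
    exact x.2 0 j.succ
  rw [h]
  exact ContinuousMap.HomotopicRel.refl _

/-- Homotopy of two image paths, restated for paths with prescribed common endpoints. -/
theorem homotopicRel_iff_path {f g : C(X, Y)} {x y : X} (γ : Path x y)
    (hx : f x = g x) (hy : f y = g y) :
    ContinuousMap.HomotopicRel (f.comp γ.toContinuousMap) (g.comp γ.toContinuousMap) {0, 1} ↔
      Path.Homotopic (γ.map f.continuous) ((γ.map g.continuous).cast hx hy) :=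
  Iff.rfl

theorem nielsenEquiv_symm (f : Fin (m + 1) → C(X, Y)) {x y : coin f}
    (h : NielsenEquiv f x y) : NielsenEquiv f y x := by
  obtain ⟨γ, hγ⟩ := h
  refine ⟨γ.symm, fun j => ?_⟩
  have h := (homotopicRel_iff_path γ (x.2 0 j.succ) (y.2 0 j.succ)).1 (hγ j)
  exact (homotopicRel_iff_path γ.symm (y.2 0 j.succ) (x.2 0 j.succ)).2 ⟨h.some.symm₂⟩

theorem nielsenEquiv_trans (f : Fin (m + 1) → C(X, Y)) {x y z : coin f}
    (h : NielsenEquiv f x y) (h' : NielsenEquiv f y z) : NielsenEquiv f x z := by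
  obtain ⟨γ, hγ⟩ := h
  obtain ⟨δ, hδ⟩ := h'
  refine ⟨γ.trans δ, fun j => ?_⟩
  have h₁ := (homotopicRel_iff_path γ (x.2 0 j.succ) (y.2 0 j.succ)).1 (hγ j)
  have h₂ := (homotopicRel_iff_path δ (y.2 0 j.succ) (z.2 0 j.succ)).1 (hδ j)
  refine (homotopicRel_iff_path (γ.trans δ) (x.2 0 j.succ) (z.2 0 j.succ)).2 ?_
  have h₃ := h₁.hcomp h₂
  rw [← Path.map_trans] at h₃
  convert h₃ using 1
  ext t
  simp only [Path.cast_coe, Path.map_coe, Function.comp_apply, Path.trans_apply]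
  split_ifs <;> rfl

/-- Nielsen equivalence as an equivalence relation on the coincidence set. -/
def nielsenSetoid (f : Fin (m + 1) → C(X, Y)) : Setoid (coin f) where
  r := NielsenEquiv f
  iseqv := ⟨nielsenEquiv_refl f, nielsenEquiv_symm f, nielsenEquiv_trans f⟩

/-- The Nielsen coincidence classes of `f 0, …, f m`. -/
def nielsenClasses (f : Fin (m + 1) → C(X, Y)) : Set (Set (coin f)) :=
  (nielsenSetoid f).classes

/-- The track `t ↦ hᵗ (γ t)` of a path `γ` under a homotopy `h`. -/
def track {f f' : C(X, Y)} (h : f.Homotopy f') {x x' : X} (γ : Path x x') : C(I, Y) :=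
  h.toContinuousMap.comp ((ContinuousMap.id I).prodMk γ.toContinuousMap)

/-- The relation, along homotopies `H i` from `f i` to `f' i`, between a set `A` of coincidences
of `f` and a set `B` of coincidences of `f'`. -/
def Related {f f' : Fin (m + 1) → C(X, Y)} (H : ∀ i, (f i).Homotopy (f' i))
    (A : Set (coin f)) (B : Set (coin f')) : Prop :=
  ∃ x ∈ A, ∃ x' ∈ B, ∃ γ : Path (x : X) (x' : X), ∀ j : Fin m,
    ContinuousMap.HomotopicRel (track (H 0) γ) (track (H j.succ) γ) {0, 1}

/-- `A` is (geometrically) essential: under all homotopies of the given maps it is related to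
some Nielsen class of the maps at the end of the homotopies. -/
def IsEssential (f : Fin (m + 1) → C(X, Y)) (A : Set (coin f)) : Prop :=
  ∀ (f' : Fin (m + 1) → C(X, Y)) (H : ∀ i, (f i).Homotopy (f' i)),
    ∃ B ∈ nielsenClasses f', Related H A B

/-- The geometric Nielsen coincidence number of `f 0, …, f m`: the number of essential
Nielsen classes. -/
noncomputable def nielsenNumber (f : Fin (m + 1) → C(X, Y)) : ℕ∞ :=
  {A | A ∈ nielsenClasses f ∧ IsEssential f A}.encard

/-- The map `(f 0, …, f 0)` into the `m`-fold power of `Y`. -/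
def diagMap (f : Fin (m + 1) → C(X, Y)) : C(X, Fin m → Y) :=
  ContinuousMap.pi fun _ => f 0

/-- The map `(f 1, …, f m)` into the `m`-fold power of `Y`. -/
def tailMap (f : Fin (m + 1) → C(X, Y)) : C(X, Fin m → Y) :=
  ContinuousMap.pi fun j => f j.succ

end

end MultiCoincidence

/-! The two coincidence sets agree, and homotopies into a power of `Y` are componentwise, so the
Nielsen classes agree. Homotopies of the `f i` induce homotopies of the pair, which gives one
direction of essentiality.

For the other, a homotopy of the pair may move the components of the diagonal map apart.
`exists_homotopy_coincidence` keeps `f 0` fixed instead: the motion `a j` of its `j`-th copy is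
undone by a further motion of the other map, which creates no coincidences and drags the existing
ones back along `a j`. `homotopicRel_track` shows that this does not affect the relation between
tracks.

The undoing is local: in a chart, a cut off translation follows a small motion. A partition of unity
splits a short time step into such moves, and connectedness of ℝ joins the steps. -/

namespace MultiCoincidence

open Set Topology

/-! ### Cutoff functions in a normed space -/

section Cutoff

variable {E : Type*} [NormedAddCommGroup E]

/-- A cutoff function equal to `1` on the ball of radius `r` and to `0` off the ball of radius
`2 * r`. -/
noncomputable def cutoff (c : E) (r : ℝ) (v : E) : ℝ :=
  max 0 (min 1 (2 - dist v c / r))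

theorem continuous_cutoff (c : E) (r : ℝ) : Continuous (cutoff c r) := by
  unfold cutoff
  fun_prop

theorem cutoff_nonneg (c : E) (r : ℝ) (v : E) : 0 ≤ cutoff c r v := le_max_left _ _

theorem cutoff_le_one (c : E) (r : ℝ) (v : E) : cutoff c r v ≤ 1 :=
  max_le zero_le_one (min_le_left _ _)

theorem cutoff_eq_one {c : E} {r : ℝ} (hr : 0 < r) {v : E} (hv : v ∈ Metric.ball c r) :
    cutoff c r v = 1 := by
  have : dist v c / r ≤ 1 := (div_le_one hr).2 (Metric.mem_ball.1 hv).le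
  unfold cutoff
  rw [min_eq_left (by linarith), max_eq_right zero_le_one]

theorem cutoff_eq_zero {c : E} {r : ℝ} (hr : 0 < r) {v : E}
    (hv : v ∉ Metric.closedBall c (2 * r)) : cutoff c r v = 0 := by
  have : 2 ≤ dist v c / r := (le_div_iff₀ hr).2 (not_le.1 hv).le
  unfold cutoff
  exact max_eq_left ((min_le_right _ _).trans (by linarith))

end Cutoff

/-! ### Transferring a homotopy from one map to the other -/

section Push

variable {X Y E : Type*} [TopologicalSpace X] [TopologicalSpace Y]
  [NormedAddCommGroup E] [NormedSpace ℝ E]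

/-- The cut off translation by `q - p` takes no point but `p` to `q`. -/
theorem add_cutoff_smul_eq_iff {c : E} {r : ℝ} (hr : 0 < r) {p q v : E}
    (hp : p ∈ Metric.ball c r) (hq : q ∈ Metric.ball c r) :
    v + cutoff c r v • (q - p) = q ↔ v = p := by
  constructor
  · intro h
    -- This convex combination puts `v` in the ball, where the cutoff is `1`.
    have hv : v = (cutoff c r v) • p + (1 - cutoff c r v) • q := by
      rw [eq_comm, ← sub_eq_zero] at h ⊢
      rw [← h]
      module
    have hmem : v ∈ Metric.ball c r := by
      rw [hv]
      exact convex_ball c r hp hq (cutoff_nonneg _ _ _) (sub_nonneg.2 (cutoff_le_one _ _ _))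
        (by ring)
    rw [cutoff_eq_one hr hmem] at hv
    simpa using hv
  · rintro rfl
    rw [cutoff_eq_one hr hp]
    simp

/-- Only points within `2 * r` of `c` move, and by at most `2 * r`; hence the radius `4 * r`. -/
theorem add_cutoff_smul_mem {c : E} {r : ℝ} (hr : 0 < r) {p q v : E} {T : Set E}
    (hT : Metric.closedBall c (4 * r) ⊆ T) (hv : v ∈ T)
    (hp : p ∈ Metric.ball c r) (hq : q ∈ Metric.ball c r) :
    v + cutoff c r v • (q - p) ∈ T := by
  by_cases h : v ∈ Metric.closedBall c (2 * r)
  · apply hT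
    rw [mem_closedBall_iff_norm] at h ⊢
    rw [mem_ball_iff_norm] at hp hq
    have h₁ : ‖q - p‖ ≤ 2 * r := by
      calc ‖q - p‖ = ‖(q - c) - (p - c)‖ := by congr 1; abel
        _ ≤ ‖q - c‖ + ‖p - c‖ := norm_sub_le _ _
        _ ≤ 2 * r := by linarith
    have h₂ : ‖cutoff c r v • (q - p)‖ ≤ 2 * r := by
      rw [norm_smul, Real.norm_of_nonneg (cutoff_nonneg _ _ _)]
      exact (mul_le_of_le_one_left (norm_nonneg _) (cutoff_le_one _ _ _)).trans h₁
    calc ‖v + cutoff c r v • (q - p) - c‖ = ‖(v - c) + cutoff c r v • (q - p)‖ := by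
          congr 1; abel
      _ ≤ ‖v - c‖ + ‖cutoff c r v • (q - p)‖ := norm_add_le _ _
      _ ≤ 4 * r := by linarith
  · rw [cutoff_eq_zero hr h]
    simpa using hv

/-- If `A` moves inside a chart ball while the time changes from `τ` to `τ + d φ`, then `g` can be
moved along so that the coincidences with `A` persist and no new ones arise. -/
theorem exists_homotopy_of_chart [T2Space Y] [ProperSpace E] (A : C(ℝ × X, Y))
    (e : OpenPartialHomeomorph Y E) {c : E} {r : ℝ} (hr : 0 < r)
    (he : Metric.closedBall c (4 * r) ⊆ e.target) {U : Set X} (hU : IsOpen U)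
    (τ φ : C(X, ℝ)) (d : ℝ) (hφ : tsupport φ ⊆ U)
    (hA : ∀ x ∈ U, ∀ s : I, A (τ x + s * (d * φ x), x) ∈ e.source ∧
      e (A (τ x + s * (d * φ x), x)) ∈ Metric.ball c r)
    (g : C(X, Y)) :
    ∃ (g' : C(X, Y)) (L : g.Homotopy g'), ∀ x,
      (g' x = A (τ x + d * φ x, x) ↔ g x = A (τ x, x)) ∧
      (g x = A (τ x, x) → ∀ s : I, L (s, x) = A (τ x + s * (d * φ x), x)) := by
  classical
  have hA₀ : ∀ x ∈ U, A (τ x, x) ∈ e.source ∧ e (A (τ x, x)) ∈ Metric.ball c r := fun x hx => by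
    simpa using hA x hx 0
  let a : I × X → Y := fun z => A (τ z.2 + z.1 * (d * φ z.2), z.2)
  have ha : Continuous a := by fun_prop
  have ha₀ : Continuous fun z : I × X => A (τ z.2, z.2) := by fun_prop
  let N : I × X → Y := fun z => e.symm (e (g z.2) + cutoff c r (e (g z.2)) •
    (e (a z) - e (A (τ z.2, z.2))))
  let W : Set (I × X) := {z | z.2 ∈ U ∧ g z.2 ∈ e.source}
  let M : I × X → Y := fun z => if z ∈ W then N z else g z.2
  have hW : IsOpen W := (hU.preimage continuous_snd).inter
    (e.open_source.preimage (g.continuous.comp continuous_snd))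
  let K : Set Y := e.symm '' Metric.closedBall c (2 * r)
  have hsub : Metric.closedBall c (2 * r) ⊆ e.target :=
    (Metric.closedBall_subset_closedBall (by linarith)).trans he
  have hK : IsClosed K :=
    ((isCompact_closedBall c (2 * r)).image_of_continuousOn
      (e.continuousOn_symm.mono hsub)).isClosed
  -- On `Z` the displacement or the cutoff vanishes, so `M` is `g` there; the open sets `W` and `Z`
  -- cover everything, which glues continuity.
  let Z : Set (I × X) := {z | z.2 ∉ tsupport φ ∨ g z.2 ∉ K}
  have hZ : IsOpen Z := ((isClosed_tsupport φ).isOpen_compl.preimage continuous_snd).union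
    (hK.isOpen_compl.preimage (g.continuous.comp continuous_snd))
  have hMW : ContinuousOn M W := by
    have hN : ContinuousOn N W := by
      have h₁ : ContinuousOn (fun z : I × X => e (g z.2)) W :=
        e.continuousOn.comp (g.continuous.comp continuous_snd).continuousOn fun z hz => hz.2
      have h₂ : ContinuousOn (fun z : I × X => e (a z)) W :=
        e.continuousOn.comp ha.continuousOn fun z hz => (hA z.2 hz.1 z.1).1
      have h₃ : ContinuousOn (fun z : I × X => e (A (τ z.2, z.2))) W :=
        e.continuousOn.comp ha₀.continuousOn fun z hz => (hA₀ z.2 hz.1).1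
      exact e.continuousOn_symm.comp
        (h₁.add (((continuous_cutoff c r).comp_continuousOn h₁).smul (h₂.sub h₃)))
        fun z hz => add_cutoff_smul_mem hr he (e.map_source hz.2) (hA₀ z.2 hz.1).2
          (hA z.2 hz.1 z.1).2
    exact hN.congr fun z hz => if_pos hz
  have hMZ : ∀ z ∈ Z, M z = g z.2 := by
    intro z hz
    by_cases hzW : z ∈ W
    · simp only [M, if_pos hzW, N]
      rcases hz with hz | hz
      · have : φ z.2 = 0 := image_eq_zero_of_notMem_tsupport hz
        simp [a, this, e.left_inv hzW.2]
      · have : e (g z.2) ∉ Metric.closedBall c (2 * r) := fun h =>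
          hz ⟨_, h, e.left_inv hzW.2⟩
        simp [cutoff_eq_zero hr this, e.left_inv hzW.2]
    · exact if_neg hzW
  have hcov : ∀ z, z ∈ W ∨ z ∈ Z := by
    intro z
    by_cases h₁ : z.2 ∈ tsupport φ
    · by_cases h₂ : g z.2 ∈ K
      · refine Or.inl ⟨hφ h₁, ?_⟩
        obtain ⟨v, hv, hv'⟩ := h₂
        rw [← hv']
        exact e.map_target (hsub hv)
      · exact Or.inr (Or.inr h₂)
    · exact Or.inr (Or.inl h₁)
  have hM : Continuous M := by
    refine continuous_iff_continuousAt.2 fun z => ?_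
    rcases hcov z with hz | hz
    · exact hMW.continuousAt (hW.mem_nhds hz)
    · have : ContinuousOn M Z :=
        ((g.continuous.comp continuous_snd).continuousOn).congr hMZ
      exact this.continuousAt (hZ.mem_nhds hz)
  have hM₀ : ∀ x, M (0, x) = g x := by
    intro x
    by_cases hz : ((0 : I), x) ∈ W
    · simp [M, if_pos hz, N, a, e.left_inv hz.2]
    · exact if_neg hz
  have hφU : ∀ x ∉ U, φ x = 0 := fun x hx =>
    image_eq_zero_of_notMem_tsupport fun h => hx (hφ h)
  have hiff : ∀ x (s : I), M (s, x) = a (s, x) ↔ g x = A (τ x, x) := by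
    intro x s
    by_cases hx : x ∈ U
    · by_cases hgx : g x ∈ e.source
      · have hz : (s, x) ∈ W := ⟨hx, hgx⟩
        simp only [M, if_pos hz, N]
        have ht := add_cutoff_smul_mem hr he (e.map_source hgx) (hA₀ x hx).2 (hA x hx s).2
        rw [← e.injOn.eq_iff (e.map_target ht) (hA x hx s).1, e.right_inv ht,
          ← e.injOn.eq_iff hgx (hA₀ x hx).1]
        exact add_cutoff_smul_eq_iff hr (hA₀ x hx).2 (hA x hx s).2
      · have hz : (s, x) ∉ W := fun h => hgx h.2
        simp only [M, if_neg hz]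
        exact iff_of_false (fun h => hgx (h ▸ (hA x hx s).1)) (fun h => hgx (h ▸ (hA₀ x hx).1))
    · have hz : (s, x) ∉ W := fun h => hx h.1
      simp [M, if_neg hz, a, hφU x hx]
  refine ⟨⟨fun x => M (1, x), by fun_prop⟩, ⟨⟨M, hM⟩, hM₀, fun x => rfl⟩, fun x => ⟨?_, ?_⟩⟩
  · simpa [a] using hiff x 1
  · intro hx s
    exact (hiff x s).2 hx

/-- `b` can be deformed so that its coincidences with `A 1` persist, following `A` backwards to
the time `τ`, and no further coincidences arise. -/
def Deforms (A : C(ℝ × X, Y)) (b : C(X, Y)) (τ : C(X, ℝ)) : Prop :=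
  ∃ (g : C(X, Y)) (L : b.Homotopy g), ∀ x,
    (g x = A (τ x, x) ↔ b x = A (1, x)) ∧
    (b x = A (1, x) → ∃ δ : Path (1 : ℝ) (τ x), ∀ s : I, L (s, x) = A (δ s, x))

theorem deforms_one (A : C(ℝ × X, Y)) (b : C(X, Y)) :
    Deforms A b (ContinuousMap.const X 1) :=
  ⟨b, .refl b, fun _ => ⟨Iff.rfl, fun h => ⟨Path.refl _, fun _ => h⟩⟩⟩

/-- The chart move is appended to `L` and a time segment to `δ`; both concatenations break at time
one half, so coincidences still follow `A`. -/
theorem Deforms.add_mul [T2Space Y] [ProperSpace E] {A : C(ℝ × X, Y)} {b : C(X, Y)}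
    {τ : C(X, ℝ)} (h : Deforms A b τ)
    (e : OpenPartialHomeomorph Y E) {c : E} {r : ℝ} (hr : 0 < r)
    (he : Metric.closedBall c (4 * r) ⊆ e.target) {U : Set X} (hU : IsOpen U)
    (φ : C(X, ℝ)) (d : ℝ) (hφ : tsupport φ ⊆ U)
    (hA : ∀ x ∈ U, ∀ s : I, A (τ x + s * (d * φ x), x) ∈ e.source ∧
      e (A (τ x + s * (d * φ x), x)) ∈ Metric.ball c r) :
    Deforms A b (τ + d • φ) := by
  obtain ⟨g, L, hL⟩ := h
  obtain ⟨g', L', hL'⟩ := exists_homotopy_of_chart A e hr he hU τ φ d hφ hA g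
  refine ⟨g', L.trans L', fun x => ⟨(hL' x).1.trans (hL x).1, fun hx => ?_⟩⟩
  obtain ⟨δ, hδ⟩ := (hL x).2 hx
  let δ' : Path (τ x) ((τ + d • φ) x) :=
    { toFun := fun s => τ x + s * (d * φ x)
      continuous_toFun := by fun_prop
      source' := by simp
      target' := by simp }
  refine ⟨δ.trans δ', fun s => ?_⟩
  rw [ContinuousMap.Homotopy.trans_apply, Path.trans_apply]
  split_ifs
  · exact hδ _
  · exact (hL' x).2 ((hL x).1.2 hx) _

/-- The times near `t₀` are equivalent for `Deforms`. -/
theorem exists_pos_deforms [CompactSpace X] [T2Space X] [T2Space Y] [ProperSpace E]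
    [ChartedSpace E Y] (A : C(ℝ × X, Y)) (b : C(X, Y)) (t₀ : ℝ) :
    ∃ ε > 0, ∀ s ∈ Metric.ball t₀ ε, ∀ s' ∈ Metric.ball t₀ ε,
      Deforms A b (ContinuousMap.const X s) → Deforms A b (ContinuousMap.const X s') := by
  have hloc : ∀ x₀ : X, ∃ (e : OpenPartialHomeomorph Y E) (c : E) (r : ℝ) (U : Set X) (ε : ℝ),
      0 < r ∧ Metric.closedBall c (4 * r) ⊆ e.target ∧ IsOpen U ∧ x₀ ∈ U ∧ 0 < ε ∧
      ∀ x ∈ U, ∀ t ∈ Metric.ball t₀ ε, A (t, x) ∈ e.source ∧ e (A (t, x)) ∈ Metric.ball c r := by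
    intro x₀
    let e := chartAt E (A (t₀, x₀))
    have hs : A (t₀, x₀) ∈ e.source := mem_chart_source E _
    obtain ⟨ρ, hρ, hρe⟩ := Metric.nhds_basis_closedBall.mem_iff.1
      (e.open_target.mem_nhds (e.map_source hs))
    have hV : IsOpen (A ⁻¹' (e.source ∩ e ⁻¹' Metric.ball (e (A (t₀, x₀))) (ρ / 4))) :=
      (e.isOpen_inter_preimage Metric.isOpen_ball).preimage A.continuous
    have hmem : (t₀, x₀) ∈ A ⁻¹' (e.source ∩ e ⁻¹' Metric.ball (e (A (t₀, x₀))) (ρ / 4)) :=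
      ⟨hs, Metric.mem_ball_self (by positivity)⟩
    obtain ⟨T, U, hT, hU, ht, hx, hTU⟩ := isOpen_prod_iff.1 hV t₀ x₀ hmem
    obtain ⟨ε, hε, hεT⟩ := Metric.isOpen_iff.1 hT t₀ ht
    refine ⟨e, e (A (t₀, x₀)), ρ / 4, U, ε, by positivity, ?_, hU, hx, hε, fun x hx t ht => ?_⟩
    · rwa [mul_div_cancel₀ _ (by norm_num)]
    · exact hTU ⟨hεT ht, hx⟩
  choose e c r U ε hr he hU hxU hε hA using hloc
  obtain ⟨S, hS⟩ := isCompact_univ.elim_finite_subcover U hU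
    fun x _ => mem_iUnion.2 ⟨x, hxU x⟩
  let u : Fin S.card → X := fun i => S.equivFin.symm i
  obtain ⟨φ, hφU, hφ₁, hφ₂, -⟩ := exists_continuous_sum_one_of_isOpen_isCompact
    (s := fun i => U (u i)) (fun i => hU _) (isCompact_univ (X := X)) (by
      intro x hx
      obtain ⟨y, hy, hxy⟩ := mem_iUnion₂.1 (hS hx)
      exact mem_iUnion.2 ⟨S.equivFin ⟨y, hy⟩, by simpa [u] using hxy⟩)
  obtain ⟨ε₀, hε₀, hle⟩ : ∃ ε₀ > 0, ∀ i, ε₀ ≤ ε (u i) := by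
    have : ∀ᶠ t in 𝓝[>] (0 : ℝ), ∀ i, t ≤ ε (u i) := Filter.eventually_all.2 fun i =>
      (Filter.Eventually.filter_mono nhdsWithin_le_nhds (eventually_le_nhds (hε (u i))))
    obtain ⟨t, ht, ht'⟩ := (this.and self_mem_nhdsWithin).exists
    exact ⟨t, ht', ht⟩
  refine ⟨ε₀, hε₀, fun s hs s' hs' h => ?_⟩
  -- Partial sums of the partition of unity carry the time from `s` to `s'` one chart at a time.
  have key : ∀ B : Finset (Fin S.card),
      Deforms A b (ContinuousMap.const X s + (s' - s) • ∑ i ∈ B, φ i) := by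
    intro B
    induction B using Finset.induction_on with
    | empty => simpa using h
    | insert i B hi ih =>
      have := ih.add_mul (e (u i)) (hr _) (he _) (hU _) (φ i) (s' - s) (hφU i) (by
        intro x hx t
        refine hA _ x hx _ (Metric.ball_subset_ball (hle i) ?_)
        have h₀ : 0 ≤ ∑ j ∈ B, φ j x := Finset.sum_nonneg fun j _ => (hφ₂ j x).1
        have h₁ : ∑ j ∈ B, φ j x + φ i x ≤ 1 := by
          have h₂ : ∑ j, φ j x = 1 := by simpa using hφ₁ (mem_univ x)
          rw [← h₂, add_comm, ← Finset.sum_insert (f := fun j => φ j x) hi]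
          exact Finset.sum_le_sum_of_subset_of_nonneg (Finset.subset_univ _)
            fun j _ _ => (hφ₂ j x).1
        set w := ∑ j ∈ B, φ j x
        have h₃ : (t : ℝ) * φ i x ≤ φ i x :=
          mul_le_of_le_one_left (hφ₂ i x).1 t.2.2
        have h₄ : 0 ≤ (t : ℝ) * φ i x := mul_nonneg t.2.1 (hφ₂ i x).1
        -- All intermediate times are convex combinations of `s` and `s'`, hence remain in the ball.
        have := (convex_ball t₀ ε₀).add_smul_sub_mem hs hs'
          (t := w + t * φ i x) ⟨by linarith, by linarith⟩
        convert this using 1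
        simp only [ContinuousMap.add_apply, ContinuousMap.const_apply, ContinuousMap.smul_apply,
          ContinuousMap.sum_apply, smul_eq_mul, w]
        ring)
      rw [Finset.sum_insert hi]
      convert this using 1
      rw [smul_add]
      abel
  convert key Finset.univ using 1
  ext x
  have h₂ : ∑ j, φ j x = 1 := by simpa using hφ₁ (mem_univ x)
  simp [h₂]

/-- Local equivalence of times makes the set of reachable times clopen, and it contains `1`. -/
theorem deforms_const [CompactSpace X] [T2Space X] [T2Space Y] [ProperSpace E]
    [ChartedSpace E Y] (A : C(ℝ × X, Y)) (b : C(X, Y)) (t : ℝ) :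
    Deforms A b (ContinuousMap.const X t) := by
  have hclopen : IsClopen {s : ℝ | Deforms A b (ContinuousMap.const X s)} := by
    constructor
    · rw [← isOpen_compl_iff, Metric.isOpen_iff]
      intro s hs
      obtain ⟨ε, hε, h⟩ := exists_pos_deforms (E := E) A b s
      exact ⟨ε, hε, fun s' hs' h' => hs (h s' hs' s (Metric.mem_ball_self hε) h')⟩
    · rw [Metric.isOpen_iff]
      intro s hs
      obtain ⟨ε, hε, h⟩ := exists_pos_deforms (E := E) A b s
      exact ⟨ε, hε, fun s' hs' => h s (Metric.mem_ball_self hε) s' hs' hs⟩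
  have := hclopen.eq_univ ⟨1, deforms_one A b⟩
  exact (Set.ext_iff.1 this t).2 (mem_univ t)

/-- A homotopy of one of two maps into a manifold can be undone by a homotopy of the other map:
the coincidence set stays the same, and every coincidence is moved along the given homotopy. -/
theorem exists_homotopy_coincidence (E : Type*) [NormedAddCommGroup E] [NormedSpace ℝ E]
    [ProperSpace E] [CompactSpace X] [T2Space X] [T2Space Y]
    [ChartedSpace E Y] {a₀ a₁ : C(X, Y)} (a : a₀.Homotopy a₁) (b : C(X, Y)) :
    ∃ (g : C(X, Y)) (L : b.Homotopy g), ∀ x,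
      (a₀ x = g x ↔ a₁ x = b x) ∧
      (a₁ x = b x → ∃ δ : Path (1 : I) 0, ∀ s : I, L (s, x) = a (δ s, x)) := by
  -- Clamping extends the homotopy to all real times, where time functions can be added freely.
  let pr : C(ℝ, I) := ⟨projIcc 0 1 zero_le_one, continuous_projIcc⟩
  have h₀ : pr 0 = 0 := projIcc_left zero_le_one
  have h₁ : pr 1 = 1 := projIcc_right zero_le_one
  obtain ⟨g, L, hL⟩ := deforms_const (E := E)
    (a.toContinuousMap.comp (pr.prodMap (ContinuousMap.id X))) b 0
  refine ⟨g, L, fun x => ?_⟩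
  have h := hL x
  simp only [ContinuousMap.comp_apply, ContinuousMap.prodMap_apply, Prod.map_apply,
    ContinuousMap.const_apply, h₀, h₁, ContinuousMap.id_apply,
    ContinuousMap.Homotopy.coe_toContinuousMap, ContinuousMap.Homotopy.apply_zero,
    ContinuousMap.Homotopy.apply_one] at h
  refine ⟨by rw [eq_comm, h.1, eq_comm], fun hx => ?_⟩
  obtain ⟨δ, hδ⟩ := h.2 hx.symm
  exact ⟨(δ.map pr.continuous).cast h₁.symm h₀.symm, hδ⟩

end Push

/-! ### Tracks of paths and essential classes -/

section Tracks

variable {X Y : Type*} [TopologicalSpace X] [TopologicalSpace Y] {m : ℕ}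

/-- The choice of path in the parameter space is immaterial, as that space is simply connected. -/
theorem homotopicRel_prodMk {S : Type*} [TopologicalSpace S] [SimplyConnectedSpace S]
    (K : C(S × X, Y)) {u v : S} (α β : Path u v) {x x' : X} {γ γ' : Path x x'}
    (h : γ.Homotopic γ') :
    ContinuousMap.HomotopicRel (K.comp (α.toContinuousMap.prodMk γ.toContinuousMap))
      (K.comp (β.toContinuousMap.prodMk γ'.toContinuousMap)) {0, 1} := by
  obtain ⟨H⟩ := SimplyConnectedSpace.paths_homotopic α β
  obtain ⟨H'⟩ := h
  exact ⟨(ContinuousMap.HomotopyRel.prod H H').compContinuousMap K⟩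

theorem homotopic_of_trans_right {y z w : Y} {p q : Path y z} (r : Path z w)
    (h : (p.trans r).Homotopic (q.trans r)) : p.Homotopic q := by
  have key : ∀ p : Path y z, ((p.trans r).trans r.symm).Homotopic p := fun p =>
    (Path.Homotopic.trans ⟨Path.Homotopy.transAssoc p r r.symm⟩
      ((Path.Homotopic.refl p).hcomp ⟨(Path.Homotopy.reflTransSymm r).symm⟩)).trans
      ⟨Path.Homotopy.transRefl p⟩
  exact (key p).symm.trans ((h.hcomp (.refl _)).trans (key q))

/-- Let `r` be the way back along `a` over `x'`. Running time forth and back is null-homotopic, so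
the constant homotopy's track is the track of `a` followed by `r`. Since `L` also moves along `r` at
`x'`, the other track is that of `b` followed by `r`. Cancel `r`. -/
theorem homotopicRel_track {f₀ f₁ a₁ b₁ g : C(X, Y)} (a : f₀.Homotopy a₁) (b : f₁.Homotopy b₁)
    (L : b₁.Homotopy g) {x x' : X} (γ : Path x x') (hx : f₀ x = f₁ x) (hx' : a₁ x' = b₁ x')
    (δ : Path (1 : I) 0) (hδ : ∀ s, L (s, x') = a (δ s, x'))
    (h : ContinuousMap.HomotopicRel (track (.refl f₀) γ) (track (b.trans L) γ) {0, 1}) :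
    ContinuousMap.HomotopicRel (track a γ) (track b γ) {0, 1} := by
  have : ContractibleSpace I := (convex_Icc (0 : ℝ) 1).contractibleSpace ⟨0, by simp⟩
  let ι : Path (0 : I) 1 := ⟨ContinuousMap.id I, rfl, rfl⟩
  let p : Path (f₀ x) (a₁ x') := ⟨track a γ, by simp [track], by simp [track]⟩
  let q : Path (f₀ x) (a₁ x') := ⟨track b γ, by simp [track, hx], by simp [track, hx']⟩
  let r : Path (a₁ x') (f₀ x') :=
    ⟨⟨fun s => a (δ s, x'), by fun_prop⟩, by simp, by simp⟩
  have hγ : γ.Homotopic (γ.trans (Path.refl x')) := ⟨(Path.Homotopy.transRefl γ).symm⟩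
  have h₁ : ContinuousMap.HomotopicRel (track (.refl f₀) γ) (p.trans r).toContinuousMap {0, 1} := by
    have e₁ : track (.refl f₀) γ = a.toContinuousMap.comp
        ((Path.refl (0 : I)).toContinuousMap.prodMk γ.toContinuousMap) := by
      ext t
      simp [track]
    have e₂ : (p.trans r).toContinuousMap = a.toContinuousMap.comp
        ((ι.trans δ).toContinuousMap.prodMk (γ.trans (Path.refl x')).toContinuousMap) := by
      ext t
      change (p.trans r) t = a ((ι.trans δ) t, (γ.trans (Path.refl x')) t)
      simp only [Path.trans_apply]
      split_ifs <;> rfl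
    rw [e₁, e₂]
    exact homotopicRel_prodMk _ _ _ hγ
  have h₂ : ContinuousMap.HomotopicRel (track (b.trans L) γ) (q.trans r).toContinuousMap {0, 1} := by
    have e₂ : (q.trans r).toContinuousMap = (b.trans L).toContinuousMap.comp
        (ι.toContinuousMap.prodMk (γ.trans (Path.refl x')).toContinuousMap) := by
      ext t
      change (q.trans r) t = (b.trans L) (t, (γ.trans (Path.refl x')) t)
      rw [ContinuousMap.Homotopy.trans_apply]
      simp only [Path.trans_apply]
      split_ifs
      · rfl
      · exact (hδ _).symm
    rw [e₂]
    exact homotopicRel_prodMk _ ι ι hγ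
  exact homotopic_of_trans_right (p := p) (q := q) r (h₁.symm.trans (h.trans h₂))

theorem homotopicRel_pi_iff {Z ι : Type*} [TopologicalSpace Z] {S : Set Z} {p q : C(Z, ι → Y)} :
    ContinuousMap.HomotopicRel p q S ↔ ∀ j, ContinuousMap.HomotopicRel
      ((ContinuousMap.eval j).comp p) ((ContinuousMap.eval j).comp q) S := by
  constructor
  · rintro ⟨H⟩ j
    exact ⟨H.compContinuousMap (ContinuousMap.eval j)⟩
  · intro h
    exact ⟨ContinuousMap.HomotopyRel.pi fun j => (h j).some⟩

/-- The target class carries no information: every coincidence lies in its own class. -/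
theorem isEssential_iff (f : Fin (m + 1) → C(X, Y)) (A : Set (coin f)) :
    IsEssential f A ↔ ∀ (f' : Fin (m + 1) → C(X, Y)) (H : ∀ i, (f i).Homotopy (f' i)),
      ∃ x ∈ A, ∃ x' : coin f', ∃ γ : Path (x : X) (x' : X), ∀ j : Fin m,
        ContinuousMap.HomotopicRel (track (H 0) γ) (track (H j.succ) γ) {0, 1} := by
  refine forall₂_congr fun f' H => ⟨?_, ?_⟩
  · rintro ⟨B, -, x, hx, x', -, h⟩
    exact ⟨x, hx, x', h⟩
  · rintro ⟨x, hx, x', h⟩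
    exact ⟨_, (nielsenSetoid f').mem_classes x', x, hx, x', (nielsenSetoid f').refl x', h⟩

theorem mem_coin_pair {Z : Type*} [TopologicalSpace Z] {p : Fin 2 → C(X, Z)} {x : X} :
    x ∈ coin p ↔ p 0 x = p 1 x := by
  refine ⟨fun h => h 0 1, fun h i j => ?_⟩
  fin_cases i <;> fin_cases j <;> simp [h]

theorem mem_coin_iff {f : Fin (m + 1) → C(X, Y)} {x : X} :
    x ∈ coin f ↔ ∀ j : Fin m, f 0 x = f j.succ x := by
  refine ⟨fun h j => h 0 j.succ, fun h => ?_⟩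
  have : ∀ i, f 0 x = f i x := Fin.cases rfl h
  exact fun i j => (this i).symm.trans (this j)

theorem coin_diagMap_tailMap (f : Fin (m + 1) → C(X, Y)) :
    coin ![diagMap f, tailMap f] = coin f := by
  ext x
  rw [mem_coin_pair, mem_coin_iff]
  exact funext_iff

/-- Both coincidence sets are the same subset of `X`. -/
def coinEquiv (f : Fin (m + 1) → C(X, Y)) : coin f ≃ coin ![diagMap f, tailMap f] :=
  Equiv.setCongr (coin_diagMap_tailMap f).symm

theorem nielsenEquiv_coinEquiv_iff (f : Fin (m + 1) → C(X, Y)) (x y : coin f) :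
    NielsenEquiv ![diagMap f, tailMap f] (coinEquiv f x) (coinEquiv f y) ↔
      NielsenEquiv f x y := by
  refine exists_congr fun γ => ?_
  rw [Fin.forall_fin_one]
  exact homotopicRel_pi_iff

theorem image_coinEquiv_mem_nielsenClasses_iff (f : Fin (m + 1) → C(X, Y)) (A : Set (coin f)) :
    coinEquiv f '' A ∈ nielsenClasses ![diagMap f, tailMap f] ↔ A ∈ nielsenClasses f := by
  have h : ∀ y, coinEquiv f '' A = {z | NielsenEquiv ![diagMap f, tailMap f] z (coinEquiv f y)} ↔
      A = {z | NielsenEquiv f z y} := by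
    intro y
    have : {z | NielsenEquiv f z y} =
        coinEquiv f ⁻¹' {z | NielsenEquiv ![diagMap f, tailMap f] z (coinEquiv f y)} := by
      ext z
      exact (nielsenEquiv_coinEquiv_iff f z y).symm
    rw [this, (coinEquiv f).image_eq_preimage_symm, (coinEquiv f).eq_preimage_iff_image_eq,
      (coinEquiv f).image_eq_preimage_symm]
  exact (coinEquiv f).surjective.exists.trans (exists_congr h)

theorem isEssential_of_image {f : Fin (m + 1) → C(X, Y)} {A : Set (coin f)}
    (h : IsEssential ![diagMap f, tailMap f] (coinEquiv f '' A)) : IsEssential f A := by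
  rw [isEssential_iff] at h ⊢
  intro f' H
  obtain ⟨_, ⟨x, hx, rfl⟩, x', γ, hγ⟩ := h ![diagMap f', tailMap f'] fun i => match i with
    | 0 => ContinuousMap.Homotopy.pi fun _ => H 0
    | 1 => ContinuousMap.Homotopy.pi fun j => H j.succ
  refine ⟨x, hx, (coinEquiv f').symm x', γ, fun j => ?_⟩
  exact homotopicRel_pi_iff.1 (hγ 0) j

end Tracks

/-! ### Equality of the Nielsen numbers -/

section Comparison

variable {X Y : Type*} [TopologicalSpace X] [TopologicalSpace Y] {m : ℕ}

theorem isEssential_image (E : Type*) [NormedAddCommGroup E] [NormedSpace ℝ E] [ProperSpace E]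
    [CompactSpace X] [T2Space X] [T2Space Y] [ChartedSpace E Y]
    {f : Fin (m + 1) → C(X, Y)} {A : Set (coin f)} (h : IsEssential f A) :
    IsEssential ![diagMap f, tailMap f] (coinEquiv f '' A) := by
  rw [isEssential_iff] at h ⊢
  intro f' H
  let a : ∀ j : Fin m, (f 0).Homotopy ((ContinuousMap.eval j).comp (f' 0)) := fun j =>
    ContinuousMap.Homotopy.comp (.refl (ContinuousMap.eval j)) (H 0)
  let b : ∀ j : Fin m, (f j.succ).Homotopy ((ContinuousMap.eval j).comp (f' 1)) := fun j =>
    ContinuousMap.Homotopy.comp (.refl (ContinuousMap.eval j)) (H 1)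
  choose g L hL using fun j => exists_homotopy_coincidence E (a j)
    ((ContinuousMap.eval j).comp (f' 1))
  -- `f 0` stays fixed, so a single first map serves all components; the motion `a j` is absorbed by
  -- `L j`.
  let H' : ∀ i, (f i).Homotopy ((Fin.cons (f 0) g : Fin (m + 1) → C(X, Y)) i) :=
    Fin.cases (.refl (f 0)) fun j => (b j).trans (L j)
  obtain ⟨x, hx, ⟨x', hx'⟩, γ, hγ⟩ := h (Fin.cons (f 0) g) H'
  have hco : ∀ j, f' 0 x' j = f' 1 x' j := fun j => (hL j x').1.1 (mem_coin_iff.1 hx' j)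
  refine ⟨coinEquiv f x, ⟨x, hx, rfl⟩, ⟨x', mem_coin_pair.2 (funext hco)⟩, γ, ?_⟩
  rw [Fin.forall_fin_one]
  refine homotopicRel_pi_iff.2 fun j => ?_
  obtain ⟨δ, hδ⟩ := (hL j x').2 (hco j)
  exact homotopicRel_track (a j) (b j) (L j) γ (x.2 0 j.succ) (hco j) δ hδ (hγ j)

theorem nielsenNumber_eq (E : Type*) [NormedAddCommGroup E] [NormedSpace ℝ E] [ProperSpace E]
    [CompactSpace X] [T2Space X] [T2Space Y] [ChartedSpace E Y] (f : Fin (m + 1) → C(X, Y)) :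
    nielsenNumber f = nielsenNumber ![diagMap f, tailMap f] := by
  refine Set.encard_congr ((Equiv.Set.congr (coinEquiv f)).subtypeEquiv fun A => ?_)
  exact and_congr (image_coinEquiv_mem_nielsenClasses_iff f A).symm
    ⟨isEssential_image E, isEssential_of_image⟩

end Comparison

theorem compactSpace_of_finite_cwComplex (X : Type*) [TopologicalSpace X] [T2Space X]
    [Topology.CWComplex (Set.univ : Set X)] [Topology.CWComplex.Finite (Set.univ : Set X)] :
    CompactSpace X := by
  have hfin : Finite (Σ n, Topology.RelCWComplex.cell (Set.univ : Set X) n) :=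
    Topology.RelCWComplex.finite_cells_of_finite
  refine ⟨?_⟩
  have h : (Set.univ : Set X) = ⋃ i : Σ n, Topology.RelCWComplex.cell (Set.univ : Set X) n,
      Topology.RelCWComplex.closedCell i.1 i.2 := by
    rw [Set.iUnion_sigma]
    exact Topology.CWComplex.union.symm
  rw [h]
  exact isCompact_iUnion fun i => Topology.RelCWComplex.isCompact_closedCell

end MultiCoincidence

theorem proposition1 {X Y : Type*}
    [TopologicalSpace X] [T2Space X] [ConnectedSpace X]
    [Topology.CWComplex (Set.univ : Set X)] [Topology.CWComplex.Finite (Set.univ : Set X)]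
    [TopologicalSpace Y] [T2Space Y]
    (n : ℕ) [ChartedSpace (EuclideanSpace ℝ (Fin n)) Y]
    (m : ℕ) (f : Fin (m + 1) → C(X, Y)) :
    MultiCoincidence.nielsenNumber f =
      MultiCoincidence.nielsenNumber
        ![MultiCoincidence.diagMap f, MultiCoincidence.tailMap f] := by
  have := MultiCoincidence.compactSpace_of_finite_cwComplex X
  exact MultiCoincidence.nielsenNumber_eq (EuclideanSpace ℝ (Fin n)) f
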